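/- Let $S$ be an oriented surface without boundary (not necessarily compact), with a locally finite triangulation $T$: a graph embedded in $S$ (loops and parallel edges allowed, every vertex of finite degree), each of whose faces is an open disk bounded by three sides of edges. Suppose that $T$ is reducing: every vertex has degree at least $8$, and the dual graph is bipartite, i.e. the triangles are coloured red and blue so that triangles sharing an edge have different colours. A walk of length $n\ge 0$ in $T$ is a sequence of $n$ consecutive directed edges (a walk of length $0$ is a single vertex). Suppose that a walk traverses a directed edge $e$, arrives at a vertex $v$, and leaves it along a directed edge $e'$. For $k\ge 0$, it makes a $k$-turn at $v$ if exactly $k$ triangles lie to its left in the cyclic order around $v$ between $e$ and $e'$; for $k\ge 1$, it makes a $-k$-turn at $v$ if exactly $k$ triangles lie to its right. A $k_r$-turn is a $k$-turn such that the triangle to the left of $e$ is red. The bad turns are the $0$-turns, $1$-turns, $-1$-turns, $2_r$-turns and $-2_r$-turns. A walk is reduced if it makes no bad turn at any of its interior vertices. Two walks with the same endpoints are homotopic if, as paths on $S$, they are homotopic with fixed endpoints. Then any two homotopic reduced walks in $T$ are equal. Moreover, every walk in $T$ is homotopic to a reduced walk; hence each homotopy class of walks contains exactly one reduced walk. -/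

import Mathlib

noncomputable section

/-- The two colours used for the triangles. -/
inductive TriangleColor where
  | red
  | blue

/-- The combinatorial data of a triangulation of an oriented surface without boundary, on a
set `D` of darts (directed edges).  Loops and parallel edges are allowed, the set of darts may be
infinite, but every vertex has finite degree. -/
structure OrientedTriangulation (D : Type*) where
  /-- The reversal of a dart; an edge is a pair `{d, rev d}`. -/
  rev : Equiv.Perm D
  rev_rev : ∀ d, rev (rev d) = d
  rev_ne : ∀ d, rev d ≠ d
  /-- The rotation system: `cw d` is the dart that follows `d` in clockwise order among the darts
  with the same source as `d`. -/
  cw : Equiv.Perm D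
  /-- Every vertex has finite degree. -/
  finite_cycle : ∀ d, {d' | cw.SameCycle d d'}.Finite
  /-- Every face is bounded by three sides of edges: the dart that follows `d` along the face to
  the left of `d` is `cw (rev d)`, and its orbits have exactly three elements. -/
  face_three : ∀ d, cw (rev (cw (rev (cw (rev d))))) = d
  face_ne : ∀ d, cw (rev d) ≠ d

namespace OrientedTriangulation

variable {D : Type*} (M : OrientedTriangulation D)

/-- The dart that follows `d` along the boundary of the triangle to the left of `d`. -/
def next (d : D) : D := M.cw (M.rev d)

/-- The vertices are the cycles of the rotation system. -/
def Vertex : Type _ := Quotient (Equiv.Perm.SameCycle.setoid M.cw)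

/-- The source of a dart. -/
def src (d : D) : M.Vertex := Quotient.mk (Equiv.Perm.SameCycle.setoid M.cw) d

/-- The target of a dart. -/
def tgt (d : D) : M.Vertex := M.src (M.rev d)

/-- The degree of a vertex: the number of darts that leave it (a loop counts twice). -/
def degree (v : M.Vertex) : ℕ := {d | M.src d = v}.ncard

/-- The directed edges from `u` to `v`. -/
instance instQuiverVertex : Quiver M.Vertex where
  Hom u v := {d : D // M.src d = u ∧ M.tgt d = v}

/-- A walk from `u` to `v` in the (undirected) graph: a finite, possibly empty, sequence of
consecutive directed edges. -/
abbrev Walk (u v : M.Vertex) : Type _ := Quiver.Path u v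

variable {M} in
/-- The sequence of darts that a walk traverses. -/
def Walk.darts {u v : M.Vertex} : M.Walk u v → List D
  | Quiver.Path.nil => []
  | Quiver.Path.cons p d => Walk.darts p ++ [d.1]

/-! ### Turns and reduced walks -/

/-- Going through `e` and then through `e'`, one makes a `k`-turn: for `k ≥ 0`, there are exactly
`k` triangles to the left, in the cyclic order around the middle vertex, between `e` and `e'`;
for `k < 0`, there are exactly `-k` triangles to the right.  (Arriving through `e`, the triangles
to the left are met by rotating clockwise from `rev e`.) -/
def IsTurn (k : ℤ) (e e' : D) : Prop :=
  k.natAbs < M.degree (M.tgt e) ∧ e' = (M.cw ^ k) (M.rev e)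

/-- `color d` is the colour of the triangle to the left of the dart `d`.  It depends on this
triangle only, and triangles that share an edge have different colours. -/
structure IsDualColoring (color : D → TriangleColor) : Prop where
  color_next : ∀ d, color (M.next d) = color d
  color_rev : ∀ d, color (M.rev d) ≠ color d

/-- A reducing triangulation, with its red/blue colouring. -/
structure IsReducing (color : D → TriangleColor) : Prop where
  coloring : M.IsDualColoring color
  eight_le_degree : ∀ v, 8 ≤ M.degree v

/-- The bad turns: `0`, `1`, `-1`, `2_r` and `-2_r`, where the index `r` means that the triangle to
the left of the first dart is red. -/
def IsBadTurn (color : D → TriangleColor) (e e' : D) : Prop :=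
  M.IsTurn 0 e e' ∨ M.IsTurn 1 e e' ∨ M.IsTurn (-1) e e' ∨
    (color e = TriangleColor.red ∧ (M.IsTurn 2 e e' ∨ M.IsTurn (-2) e e'))

variable {M} in
/-- A walk is reduced if none of its interior vertices makes a bad turn. -/
def Walk.IsReduced (color : D → TriangleColor) {u v : M.Vertex} (W : M.Walk u v) : Prop :=
  (Walk.darts W).IsChain fun e e' => ¬ M.IsBadTurn color e e'

/-! ### The surface obtained by gluing triangles -/

/-- Permutation of the barycentric coordinates of a triangle. -/
def permute (σ : Equiv.Perm (Fin 3)) (x : stdSimplex ℝ (Fin 3)) : stdSimplex ℝ (Fin 3) :=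
  ⟨fun i => x.1 (σ i), fun i => x.2.1 (σ i), by
    rw [Equiv.sum_comp σ x.1]; exact x.2.2⟩

/-- The gluing relation on the disjoint union of one closed triangle for each dart `d`, whose
vertices `0`, `1`, `2` are the source of `d`, the target of `d` and the third vertex of the
triangle to the left of `d`.  The three copies of a same triangle are identified, and so are
the sides that correspond to the darts `d` and `rev d`, with opposite directions. -/
inductive Glue : ((_ : D) × stdSimplex ℝ (Fin 3)) → ((_ : D) × stdSimplex ℝ (Fin 3)) → Prop
  | rotate (d : D) (x : stdSimplex ℝ (Fin 3)) :
      Glue ⟨d, x⟩ ⟨M.next d, permute (finRotate 3) x⟩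
  | edge (d : D) (x : stdSimplex ℝ (Fin 3)) (hx : x.1 2 = 0) :
      Glue ⟨d, x⟩ ⟨M.rev d, permute (Equiv.swap 0 1) x⟩

/-- The topological space obtained by gluing the triangles, with the quotient topology. -/
def Realization : Type _ := Quot M.Glue

instance instTopologicalSpaceRealization : TopologicalSpace M.Realization :=
  inferInstanceAs (TopologicalSpace (Quot M.Glue))

/-- The point of the realization with barycentric coordinates `x` in the triangle of `d`. -/
def toRealization (d : D) (x : stdSimplex ℝ (Fin 3)) : M.Realization := Quot.mk M.Glue ⟨d, x⟩

/-- The point with barycentric coordinates `(1 - t, t, 0)`. -/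
def sidePoint (t : unitInterval) : stdSimplex ℝ (Fin 3) :=
  ⟨![1 - (t : ℝ), t, 0], by
    intro i
    fin_cases i
    · exact sub_nonneg.2 t.2.2
    · exact t.2.1
    · exact le_rfl, by
    simp [Fin.sum_univ_three]⟩

theorem continuous_sidePoint : Continuous sidePoint := by
  refine Continuous.subtype_mk (continuous_pi fun i => ?_) _
  fin_cases i
  · exact continuous_const.sub continuous_subtype_val
  · exact continuous_subtype_val
  · exact continuous_const

theorem toRealization_rev (d : D) (t : unitInterval) :
    M.toRealization d (sidePoint t) = M.toRealization (M.rev d) (sidePoint (unitInterval.symm t)) := by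
  have h := Quot.sound (Glue.edge (M := M) d (sidePoint t) rfl)
  refine h.trans (congrArg (M.toRealization (M.rev d)) (Subtype.ext (funext fun i => ?_)))
  fin_cases i <;> simp [permute, sidePoint, Equiv.swap_apply_def]

theorem toRealization_next (d : D) :
    M.toRealization d (sidePoint 1) = M.toRealization (M.next d) (sidePoint 0) := by
  have h := Quot.sound (Glue.rotate (M := M) d (sidePoint 1))
  refine h.trans (congrArg (M.toRealization (M.next d)) (Subtype.ext (funext fun i => ?_)))
  fin_cases i <;> simp [permute, sidePoint]

theorem toRealization_cw (d : D) :
    M.toRealization (M.cw d) (sidePoint 0) = M.toRealization d (sidePoint 0) := by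
  rw [M.toRealization_rev d 0, unitInterval.symm_zero, M.toRealization_next, next, M.rev_rev]

theorem toRealization_zpow (k : ℤ) (d : D) :
    M.toRealization ((M.cw ^ k) d) (sidePoint 0) = M.toRealization d (sidePoint 0) := by
  induction k generalizing d with
  | zero => rfl
  | succ n ih => rw [zpow_add_one, Equiv.Perm.mul_apply, ih, toRealization_cw]
  | pred n ih =>
    rw [zpow_sub_one, Equiv.Perm.mul_apply, ih, ← M.toRealization_cw, Equiv.Perm.inv_def,
      Equiv.apply_symm_apply]

/-- The position of a vertex in the realization. -/
def vertexPoint (v : M.Vertex) : M.Realization :=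
  Quotient.lift (fun d => M.toRealization d (sidePoint 0)) (by
    rintro d _ ⟨k, rfl⟩
    exact (M.toRealization_zpow k d).symm) v

/-- A dart, seen as a path in the realization. -/
def dartPath (d : D) : Path (M.vertexPoint (M.src d)) (M.vertexPoint (M.tgt d)) where
  toFun t := M.toRealization d (sidePoint t)
  continuous_toFun :=
    continuous_quot_mk.comp (continuous_sigmaMk.comp continuous_sidePoint)
  source' := rfl
  target' := (M.toRealization_rev d 1).trans (by rw [unitInterval.symm_one]; rfl)

variable {M} in
/-- A walk, seen as a path in the realization. -/
def Walk.toPath {u v : M.Vertex} : M.Walk u v → Path (M.vertexPoint u) (M.vertexPoint v)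
  | Quiver.Path.nil => Path.refl _
  | Quiver.Path.cons p d =>
      (Walk.toPath p).trans ((M.dartPath d.1).cast
        (congrArg M.vertexPoint d.2.1.symm) (congrArg M.vertexPoint d.2.2.symm))

end OrientedTriangulation

/-- A triangulation of the oriented surface `S` (without boundary, not necessarily compact):
combinatorial data, and a homeomorphism from the glued triangles to `S`. -/
structure SurfaceTriangulation (D S : Type*) [TopologicalSpace S] extends
    OrientedTriangulation D where
  /-- The homeomorphism that carries the glued triangles onto the surface. -/
  homeo : toOrientedTriangulation.Realization ≃ₜ S

namespace SurfaceTriangulation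

variable {D S : Type*} [TopologicalSpace S] (T : SurfaceTriangulation D S)

/-- The position of a vertex on the surface. -/
def point (v : T.Vertex) : S := T.homeo (T.vertexPoint v)

/-- A walk of the triangulation, seen as a path on the surface. -/
def walkPath {u v : T.Vertex} (W : T.Walk u v) : Path (T.point u) (T.point v) :=
  (OrientedTriangulation.Walk.toPath W).map T.homeo.continuous

/-- Two walks are homotopic if they are so as paths on the surface, with fixed endpoints. -/
def Homotopic {u v : T.Vertex} (W₁ W₂ : T.Walk u v) : Prop :=
  Path.Homotopic (T.walkPath W₁) (T.walkPath W₂)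

end SurfaceTriangulation

end

noncomputable section

open Relation Topology

/-! Reducing a walk is a rewriting process on its list of darts. A bad turn is a spur, a ±1-turn
along two sides of a triangle, or a ±2-turn that can be pushed across two adjacent triangles; `Step`
removes one of them. For a reducing triangulation, the reduced walks are exactly those whose list
admits no step (`IsReducing.isChain_iff`). Steps terminate (`Step.measure_lt`) and are locally
confluent (`Step.join`), so by Newman's lemma two irreducible lists that are equivalent modulo steps
are equal (`IsReducing.eq_of_eqvGen`).

It remains to compare this equivalence with homotopy. Each step is a homotopy
(`Replaceable.of_step`), so termination yields a reduced walk in every class. Conversely, let G be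
the group of units of the monoid presented by the darts, modulo the spur and triangle relations.
Gluing copies of the triangles indexed by G gives a covering in which the lift of a walk ends in the
sheet given by the product of its darts. Homotopic walks have lifts with the same end, hence the
same product (`Cocycle.prod_eq_of_homotopic`), and the same product means equivalence modulo steps
(`eqvGen_step_of_prod_eq`). -/

/-- The other colour. -/
def TriangleColor.other : TriangleColor → TriangleColor
  | red => blue
  | blue => red

theorem TriangleColor.eq_other_of_ne {x y : TriangleColor} (h : x ≠ y) : x = y.other := by
  cases x <;> cases y <;> simp_all [TriangleColor.other]

/-- Newman's lemma: a terminating and locally confluent relation is confluent. -/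
theorem WellFounded.join_of_locally_confluent {α : Type*} {r : α → α → Prop}
    (hwf : WellFounded fun x y => r y x)
    (hr : ∀ a b c, r a b → r a c → Join (ReflTransGen r) b c) {a b c : α}
    (hab : ReflTransGen r a b) (hac : ReflTransGen r a c) : Join (ReflTransGen r) b c := by
  induction a using hwf.induction generalizing b c with
  | _ a ih =>
    rcases hab.cases_head with rfl | ⟨b', hb', hbb⟩
    · exact ⟨c, hac, .refl⟩
    rcases hac.cases_head with rfl | ⟨c', hc', hcc⟩
    · exact ⟨b, .refl, hab⟩
    obtain ⟨d, hbd, hcd⟩ := hr a b' c' hb' hc'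
    obtain ⟨e, hbe, hde⟩ := ih b' hb' hbb hbd
    obtain ⟨f, hef, hcf⟩ := ih c' hc' (hcd.trans hde) hcc
    exact ⟨f, hbe.trans hef, hcf⟩

/-! ### Identities in the rotation system. -/

namespace OrientedTriangulation

variable {D : Type*} (M : OrientedTriangulation D)

@[simp]
theorem rev_rev' (d : D) : M.rev (M.rev d) = d := M.rev_rev d

@[simp]
theorem next_next_next (d : D) : M.next (M.next (M.next d)) = d := M.face_three d

theorem next_ne (d : D) : M.next d ≠ d := M.face_ne d

theorem next_next_ne (d : D) : M.next (M.next d) ≠ d := fun h =>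
  M.next_ne d ((congrArg M.next h).symm.trans (M.next_next_next d))

theorem cw_apply (d : D) : M.cw d = M.next (M.rev d) := by simp [next]

theorem cw_inv_apply (d : D) : M.cw⁻¹ d = M.rev (M.next (M.next d)) := by
  rw [Equiv.Perm.inv_eq_iff_eq, cw_apply]; simp

theorem src_cw_zpow (k : ℤ) (d : D) : M.src ((M.cw ^ k) d) = M.src d :=
  Quotient.sound (Equiv.Perm.SameCycle.zpow_left (Equiv.Perm.SameCycle.refl M.cw d))

theorem src_next (d : D) : M.src (M.next d) = M.tgt d := M.src_cw_zpow 1 (M.rev d)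

theorem tgt_rev (d : D) : M.tgt (M.rev d) = M.src d := by simp [tgt]

/-- A power of the rotation that fixes a dart is at least the degree. -/
theorem degree_le_of_pow_fixed {d : D} {n : ℕ} (hn : 0 < n) (h : (M.cw ^ n) d = d) :
    M.degree (M.src d) ≤ n := by
  have hsub : {d' | M.src d' = M.src d} ⊆ (fun i => (M.cw ^ i) d) '' Set.Iio n := by
    intro d' hd'
    obtain ⟨k, hk⟩ := (Quotient.exact hd' : M.cw.SameCycle d' d).symm
    have hfix : (M.cw ^ ((n : ℤ) * (k / n))) d = d := by
      rw [zpow_mul, zpow_natCast]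
      exact Function.IsFixedPt.perm_zpow h _
    refine ⟨(k % n).toNat, ?_, ?_⟩
    · have := Int.emod_lt_of_pos k (Int.natCast_pos.2 hn)
      simp only [Set.mem_Iio]; omega
    · have h0 : ((k % n).toNat : ℤ) = k % n :=
        Int.toNat_of_nonneg (Int.emod_nonneg _ (by omega))
      have h1 : (M.cw ^ (k % n).toNat) d = (M.cw ^ (k % n)) d := by
        rw [← zpow_natCast, h0]
      change (M.cw ^ (k % n).toNat) d = d'
      rw [h1, ← hk]
      conv_rhs => rw [← Int.emod_add_mul_ediv k n, zpow_add, Equiv.Perm.mul_apply]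
      rw [hfix]
  refine (Set.ncard_le_ncard hsub ((Set.finite_Iio n).image _)).trans ?_
  refine (Set.ncard_image_le (Set.finite_Iio n)).trans ?_
  rw [Set.ncard_eq_toFinset_card']; simp

namespace IsDualColoring

variable {M} {color : D → TriangleColor} (h : M.IsDualColoring color)
include h

theorem color_rev_eq (d : D) : color (M.rev d) = (color d).other :=
  TriangleColor.eq_other_of_ne (h.color_rev d)

end IsDualColoring

/-! ### Shortcuts -/

/-- `Shortcut color a b m` means that `b` makes a bad turn after `a` and that the walk `a`, `b`
can be replaced with the walk `m`. -/
inductive Shortcut (color : D → TriangleColor) (a b : D) : List D → Prop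
  | spur (h : b = M.rev a) : Shortcut color a b []
  | left (h : b = M.next a) : Shortcut color a b [M.rev (M.next (M.next a))]
  | right (h : b = M.rev (M.next (M.next (M.rev a)))) : Shortcut color a b [M.next (M.rev a)]
  | flipLeft (hc : color a = TriangleColor.red) (h : b = M.next (M.rev (M.next a))) :
      Shortcut color a b
        [M.rev (M.next (M.next a)), M.rev (M.next (M.next (M.rev (M.next a))))]
  | flipRight (hc : color a = TriangleColor.red)
      (h : b = M.rev (M.next (M.next (M.rev (M.next (M.next (M.rev a))))))) :
      Shortcut color a b [M.next (M.rev a), M.next (M.rev (M.next (M.next (M.rev a))))]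

/-- One replacement of a bad turn inside a walk. -/
inductive Step (color : D → TriangleColor) : List D → List D → Prop
  | head {a b : D} {m : List D} (l : List D) (h : M.Shortcut color a b m) :
      Step color (a :: b :: l) (m ++ l)
  | cons (a : D) {l l' : List D} (h : Step color l l') : Step color (a :: l) (a :: l')

variable {M} {color : D → TriangleColor}

theorem Step.append_right {l l' : List D} (h : M.Step color l l') (k : List D) :
    M.Step color (l ++ k) (l' ++ k) := by
  induction h with
  | head l h => simpa using Step.head (l ++ k) h
  | cons a h ih => exact ih.cons a

theorem Step.append_left {l l' : List D} (h : M.Step color l l') (k : List D) :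
    M.Step color (k ++ l) (k ++ l') := by
  induction k with
  | nil => exact h
  | cons a k ih => exact ih.cons a

/-- If the exponents differed, a positive power of the rotation with exponent at most 4 would fix
`d`, against degree at least 8. Hence the five kinds of shortcut exclude one another. -/
theorem IsReducing.cw_zpow_injective (hM : M.IsReducing color) {d : D} {j k : ℤ}
    (hj : |j| ≤ 2) (hk : |k| ≤ 2) (h : (M.cw ^ j) d = (M.cw ^ k) d) : j = k := by
  wlog hjk : j ≤ k generalizing j k
  · exact (this hk hj h.symm (by omega)).symm
  by_contra hne
  have hn : (M.cw ^ (k - j).toNat) d = d := by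
    rw [← zpow_natCast, Int.toNat_of_nonneg (by omega), sub_eq_neg_add, zpow_add,
      Equiv.Perm.mul_apply, ← h, ← Equiv.Perm.mul_apply, ← zpow_add]
    simp
  have h1 := M.degree_le_of_pow_fixed (by omega) hn
  have h2 := hM.eight_le_degree (M.src d)
  rw [abs_le] at hj hk
  omega

variable (M) in
/-- The walk that replaces a bad `k`-turn after `a`. -/
def replacement (k : ℤ) (a : D) : List D :=
  if k = 0 then [] else if k = 1 then [M.rev (M.next (M.next a))]
  else if k = -1 then [M.next (M.rev a)]
  else if k = 2 then [M.rev (M.next (M.next a)), M.rev (M.next (M.next (M.rev (M.next a))))]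
  else [M.next (M.rev a), M.next (M.rev (M.next (M.next (M.rev a))))]

variable (M) in
theorem cw_zpow_two (d : D) : (M.cw ^ (2 : ℤ)) d = M.next (M.rev (M.next (M.rev d))) := by
  rw [zpow_ofNat, pow_two, Equiv.Perm.mul_apply, cw_apply, cw_apply]

variable (M) in
theorem cw_zpow_neg_one (d : D) : (M.cw ^ (-1 : ℤ)) d = M.rev (M.next (M.next d)) := by
  rw [zpow_neg_one, cw_inv_apply]

variable (M) in
theorem cw_zpow_neg_two (d : D) :
    (M.cw ^ (-2 : ℤ)) d = M.rev (M.next (M.next (M.rev (M.next (M.next d))))) := by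
  rw [show (-2 : ℤ) = -1 + -1 by rfl, zpow_add, Equiv.Perm.mul_apply, cw_zpow_neg_one,
    cw_zpow_neg_one]

theorem Shortcut.exists_turn {a b : D} {m : List D} (h : M.Shortcut color a b m) :
    ∃ k : ℤ, |k| ≤ 2 ∧ b = (M.cw ^ k) (M.rev a) ∧ m = M.replacement k a := by
  cases h with
  | spur h => exact ⟨0, by simp, by simpa using h, rfl⟩
  | left h => exact ⟨1, by simp, by simpa [cw_apply] using h, rfl⟩
  | right h => exact ⟨-1, by simp, by rwa [cw_zpow_neg_one], rfl⟩
  | flipLeft hc h => exact ⟨2, by simp, by rwa [cw_zpow_two, rev_rev'], rfl⟩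
  | flipRight hc h => exact ⟨-2, by simp, by rwa [cw_zpow_neg_two], rfl⟩

theorem Shortcut.unique (hM : M.IsReducing color) {a b : D} {m m' : List D}
    (h : M.Shortcut color a b m) (h' : M.Shortcut color a b m') : m = m' := by
  obtain ⟨k, hk, hb, rfl⟩ := h.exists_turn
  obtain ⟨j, hj, hb', rfl⟩ := h'.exists_turn
  rw [hM.cw_zpow_injective hk hj (hb.symm.trans hb')]

theorem IsReducing.isTurn_iff (hM : M.IsReducing color) {k : ℤ} (hk : |k| ≤ 2) (a b : D) :
    M.IsTurn k a b ↔ b = (M.cw ^ k) (M.rev a) := by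
  refine and_iff_right ?_
  have := hM.eight_le_degree (M.tgt a)
  rw [abs_le] at hk
  omega

theorem IsReducing.isBadTurn_iff (hM : M.IsReducing color) (a b : D) :
    M.IsBadTurn color a b ↔ ∃ m, M.Shortcut color a b m := by
  rw [IsBadTurn, hM.isTurn_iff (by simp), hM.isTurn_iff (by simp), hM.isTurn_iff (by simp),
    hM.isTurn_iff (by simp), hM.isTurn_iff (by simp), cw_zpow_two, cw_zpow_neg_two,
    cw_zpow_neg_one, rev_rev']
  constructor
  · rintro (h | h | h | ⟨hc, h | h⟩)
    · exact ⟨_, .spur (by simpa using h)⟩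
    · exact ⟨_, .left (by simpa [cw_apply] using h)⟩
    · exact ⟨_, .right h⟩
    · exact ⟨_, .flipLeft hc h⟩
    · exact ⟨_, .flipRight hc h⟩
  · rintro ⟨m, h | h | h | ⟨hc, h⟩ | ⟨hc, h⟩⟩
    · exact .inl (by simpa using h)
    · exact .inr (.inl (by simpa [cw_apply] using h))
    · exact .inr (.inr (.inl h))
    · exact .inr (.inr (.inr ⟨hc, .inl h⟩))
    · exact .inr (.inr (.inr ⟨hc, .inr h⟩))

/-- A list of darts makes no bad turn if and only if it admits no step. -/
theorem IsReducing.isChain_iff (hM : M.IsReducing color) (l : List D) :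
    (l.IsChain fun e e' => ¬ M.IsBadTurn color e e') ↔ ∀ l', ¬ M.Step color l l' := by
  induction l with
  | nil => exact ⟨fun _ _ h => (by cases h), fun _ => .nil⟩
  | cons a l ih =>
    cases l with
    | nil => exact ⟨fun _ _ h => (by cases h with | cons _ h => cases h), fun _ => .singleton _⟩
    | cons b l =>
      rw [List.isChain_cons_cons, ih, hM.isBadTurn_iff]
      constructor
      · rintro ⟨h1, h2⟩ _ (⟨_, h⟩ | ⟨_, h⟩)
        · exact h1 ⟨_, h⟩
        · exact h2 _ h
      · exact fun h => ⟨fun ⟨m, hm⟩ => h _ (.head l hm), fun l' hl => h _ (hl.cons a)⟩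

/-! ### Termination -/

/-- The sum of the positions, counted from the end, of the darts with a red triangle on their
left. -/
def redWeight (color : D → TriangleColor) : List D → ℕ
  | [] => 0
  | a :: l => (match color a with | .red => l.length + 1 | .blue => 0) + redWeight color l

/-- Spurs and ±1-turns shorten the list. A flip keeps the length and turns the colours red, blue of
the two darts into blue, red: the red dart moves one place towards the end, where it weighs less. -/
theorem Step.measure_lt (hM : M.IsDualColoring color) {l l' : List D} (h : M.Step color l l') :
    l'.length < l.length ∨
      (l'.length = l.length ∧ redWeight color l' < redWeight color l) := by
  induction h with
  | head l h =>
    cases h with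
    | spur h => left; simp
    | left h => left; simp
    | right h => left; simp
    | flipLeft hc h =>
      right
      subst h
      simp [redWeight, hM.color_next, hM.color_rev_eq, hc, TriangleColor.other]
    | flipRight hc h =>
      right
      subst h
      simp [redWeight, hM.color_next, hM.color_rev_eq, hc, TriangleColor.other]
  | cons a h ih =>
    rcases ih with h | ⟨h, h'⟩
    · left; simpa using h
    · right
      refine ⟨by simp [h], ?_⟩
      simp only [redWeight, h]
      omega

theorem Step.wellFounded (hM : M.IsDualColoring color) :
    WellFounded fun l l' : List D => M.Step color l' l := by
  refine Subrelation.wf (r := InvImage (Prod.Lex (· < ·) (· < ·))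
    fun l => (l.length, redWeight color l)) ?_
    (InvImage.wf _ (WellFounded.prod_lex wellFounded_lt wellFounded_lt))
  intro l l' h
  rcases h.measure_lt hM with h | ⟨h, h'⟩
  · exact Prod.Lex.left _ _ h
  · simp only [InvImage, h]
    exact Prod.Lex.right _ h'

/-! ### Confluence -/

/-- The shortcuts solved for the first dart. In an overlap `a`, `b`, `c` every dart is then a word
in `rev` and `next` applied to the middle dart `b`. -/
theorem Shortcut.eq_left {a b : D} {m : List D} (h : M.Shortcut color a b m) :
    (a = M.rev b ∧ m = []) ∨
    (a = M.next (M.next b) ∧ m = [M.rev (M.next b)]) ∨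
    (a = M.rev (M.next (M.rev b)) ∧ m = [M.next (M.next (M.rev b))]) ∨
    (color a = TriangleColor.red ∧ a = M.next (M.next (M.rev (M.next (M.next b)))) ∧
      m = [M.rev (M.next (M.rev (M.next (M.next b)))), M.rev (M.next b)]) ∨
    (color a = TriangleColor.red ∧ a = M.rev (M.next (M.rev (M.next (M.rev b)))) ∧
      m = [M.next (M.next (M.rev (M.next (M.rev b)))), M.next (M.next (M.rev b))]) := by
  cases h with
  | spur h => subst h; simp
  | left h => subst h; simp
  | right h => subst h; simp
  | flipLeft hc h => subst h; simp [hc]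
  | flipRight hc h => subst h; simp [hc]

/-- The critical pairs. A flip at `a`, `b` forces `b` to be blue and a flip at `b`, `c` forces it to
be red, so two flips never overlap; each remaining case is a short computation. -/
theorem Shortcut.join (hM : M.IsDualColoring color) {a b c : D} {m m' : List D}
    (h : M.Shortcut color a b m) (h' : M.Shortcut color b c m') (l : List D) :
    Join (ReflTransGen (M.Step color)) (m ++ c :: l) (a :: (m' ++ l)) := by
  obtain hb | hb : color b = .red ∨ color b = .blue := by cases color b <;> simp
  all_goals
    rcases h.eq_left with ⟨rfl, rfl⟩ | ⟨rfl, rfl⟩ | ⟨rfl, rfl⟩ | ⟨hc, rfl, rfl⟩ | ⟨hc, rfl, rfl⟩ <;>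
    rcases h' with h' | h' | h' | ⟨hc', h'⟩ | ⟨hc', h'⟩ <;> subst h' <;>
    (try simp only [hM.color_next, hM.color_rev_eq, hb, TriangleColor.other, reduceCtorEq] at hc) <;>
    (try simp only [hb, reduceCtorEq] at hc') <;>
    clear h
  all_goals
    -- The common descendant stays a metavariable: the first list is reduced greedily and its end
    -- instantiates the witness, which the second list must then reach. Only three darts are
    -- explicit, so steps at the first two positions suffice.
    apply Exists.intro
    apply And.intro
    all_goals
      simp only [List.cons_append, List.nil_append]
      repeat
        apply ReflTransGen.head
        on_goal 1 =>
          first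
          | refine .head _ (.spur ?_) <;>
              (simp; done)
          | refine .head _ (.left ?_) <;>
              (simp; done)
          | refine .head _ (.right ?_) <;>
              (simp; done)
          | refine .head _ (.flipLeft ?_ ?_) <;>
              (simp [hM.color_next, hM.color_rev_eq, hb, TriangleColor.other]; done)
          | refine .head _ (.flipRight ?_ ?_) <;>
              (simp [hM.color_next, hM.color_rev_eq, hb, TriangleColor.other]; done)
          | refine .cons _ (.head _ (.spur ?_)) <;>
              (simp; done)
          | refine .cons _ (.head _ (.left ?_)) <;>
              (simp; done)
          | refine .cons _ (.head _ (.right ?_)) <;>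
              (simp; done)
          | refine .cons _ (.head _ (.flipLeft ?_ ?_)) <;>
              simp [hM.color_next, hM.color_rev_eq, hb, TriangleColor.other]
          | refine .cons _ (.head _ (.flipRight ?_ ?_)) <;>
              simp [hM.color_next, hM.color_rev_eq, hb, TriangleColor.other]
        simp only [List.cons_append, List.nil_append, rev_rev', next_next_next]
      exact ReflTransGen.refl

theorem join_map {α : Type*} {r : α → α → Prop} {f : α → α} (hf : ∀ x y, r x y → r (f x) (f y))
    {a b : α} (h : Join (ReflTransGen r) a b) : Join (ReflTransGen r) (f a) (f b) :=
  let ⟨c, hac, hbc⟩ := h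
  ⟨f c, hac.lift f hf, hbc.lift f hf⟩

theorem Step.join (hM : M.IsReducing color) (l l₁ l₂ : List D)
    (h₁ : M.Step color l l₁) (h₂ : M.Step color l l₂) :
    Join (ReflTransGen (M.Step color)) l₁ l₂ := by
  have sym : ∀ x y, Join (ReflTransGen (M.Step color)) x y →
      Join (ReflTransGen (M.Step color)) y x := fun x y ⟨z, hx, hy⟩ => ⟨z, hy, hx⟩
  have overlap : ∀ {a b : D} {m l l₂ : List D}, M.Shortcut color a b m →
      M.Step color (b :: l) l₂ → Join (ReflTransGen (M.Step color)) (m ++ l) (a :: l₂) := by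
    intro a b m l l₂ h h₂
    cases h₂ with
    | head l h' => exact h.join hM.coloring h' l
    -- The second step takes place beyond `b`, so the two steps commute.
    | cons _ h' => exact ⟨_, .single (h'.append_left m), .single (.head _ h)⟩
  induction h₁ generalizing l₂ with
  | head l h =>
    cases h₂ with
    | head _ h' => rw [h.unique hM h']; exact ⟨_, .refl, .refl⟩
    | cons _ h' => exact overlap h h'
  | cons a h ih =>
    cases h₂ with
    | head l h' => exact sym _ _ (overlap h' h)
    | cons _ h' => exact join_map (fun _ _ h => h.cons a) (ih _ h')

/-- Confluence makes joinability transitive, so equivalent lists have a common descendant; an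
irreducible list is its own only descendant. -/
theorem IsReducing.eq_of_eqvGen (hM : M.IsReducing color) {l l' : List D}
    (hl : ∀ k, ¬ M.Step color l k) (hl' : ∀ k, ¬ M.Step color l' k)
    (h : EqvGen (M.Step color) l l') : l = l' := by
  have key : Join (ReflTransGen (M.Step color)) l l' := by
    clear hl hl'
    induction h with
    | rel x y h => exact ⟨y, .single h, .refl⟩
    | refl x => exact ⟨x, .refl, .refl⟩
    | symm x y _ ih => obtain ⟨z, hx, hy⟩ := ih; exact ⟨z, hy, hx⟩
    | trans x y z _ _ ih₁ ih₂ =>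
      obtain ⟨u, hx, hy⟩ := ih₁
      obtain ⟨v, hy', hz⟩ := ih₂
      obtain ⟨w, huw, hvw⟩ :=
        WellFounded.join_of_locally_confluent (Step.wellFounded hM.coloring) (Step.join hM) hy hy'
      exact ⟨w, hx.trans huw, hz.trans hvw⟩
  obtain ⟨k, hk, hk'⟩ := key
  have e : ∀ {l k : List D}, (∀ k, ¬ M.Step color l k) → ReflTransGen (M.Step color) l k → l = k :=
    fun hl h => by
      rcases h.cases_head with h | ⟨_, h, _⟩
      · exact h
      · exact absurd h (hl _)
  rw [e hl hk, e hl' hk']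

end OrientedTriangulation

namespace OrientedTriangulation

variable {D : Type*} (M : OrientedTriangulation D)

/-! ### Words modulo the relations given by the edges and the triangles -/

/-- The relations between words that come from edges and from triangles. -/
inductive WordRel : FreeMonoid D → FreeMonoid D → Prop
  | spur (d : D) : WordRel (.of d * .of (M.rev d)) 1
  | triangle (d : D) : WordRel (.of d * .of (M.next d)) (.of (M.rev (M.next (M.next d))))

/-- The words modulo the relations that come from edges and from triangles. -/
abbrev WordMonoid : Type _ := (conGen M.WordRel).Quotient

/-- The class of a dart, as an invertible element. -/
def dartUnit (d : D) : M.WordMonoidˣ where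
  val := ((FreeMonoid.of d : FreeMonoid D) : M.WordMonoid)
  inv := ((FreeMonoid.of (M.rev d) : FreeMonoid D) : M.WordMonoid)
  val_inv := (Con.eq _).2 (.of _ _ (.spur d))
  inv_val := (Con.eq _).2 (.of _ _ (by simpa using WordRel.spur (M := M) (M.rev d)))

/-- An assignment of group elements to the darts, compatible with reversal and with triangles. -/
structure Cocycle (G : Type*) [Group G] where
  /-- The element assigned to a dart. -/
  toFun : D → G
  map_rev : ∀ d, toFun (M.rev d) = (toFun d)⁻¹
  map_face : ∀ d, toFun d * toFun (M.next d) * toFun (M.next (M.next d)) = 1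

/-- The universal cocycle. -/
def universalCocycle : M.Cocycle M.WordMonoidˣ where
  toFun := M.dartUnit
  map_rev d := by
    refine Units.ext ?_
    rfl
  map_face d := by
    have h1 : M.dartUnit d * M.dartUnit (M.next d) = M.dartUnit (M.rev (M.next (M.next d))) :=
      Units.ext ((Con.eq _).2 (.of _ _ (.triangle d)))
    have h2 : M.dartUnit (M.rev (M.next (M.next d))) = (M.dartUnit (M.next (M.next d)))⁻¹ :=
      Units.ext rfl
    rw [h1, h2, inv_mul_cancel]

theorem coe_prod_dartUnit (l : List D) :
    (((l.map M.dartUnit).prod : M.WordMonoidˣ) : M.WordMonoid) =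
      ((FreeMonoid.ofList l : FreeMonoid D) : M.WordMonoid) := by
  induction l with
  | nil => rfl
  | cons a l ih =>
    rw [List.map_cons, List.prod_cons, Units.val_mul, ih]
    rfl

theorem eqvGen_map {α β : Type*} {r : α → α → Prop} {s : β → β → Prop} {f : α → β}
    (hf : ∀ x y, r x y → s (f x) (f y)) {a b : α} (h : EqvGen r a b) : EqvGen s (f a) (f b) := by
  induction h with
  | rel x y h => exact .rel _ _ (hf _ _ h)
  | refl x => exact .refl _
  | symm x y _ ih => exact .symm _ _ ih
  | trans x y z _ _ ih₁ ih₂ => exact .trans _ _ _ ih₁ ih₂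

/-- The two defining relations are themselves steps (`spur` and `left`), and steps are stable under
concatenation. Darts are already invertible in the monoid, so its congruence can be compared with
steps directly, without formal inverses. -/
theorem eqvGen_step_of_prod_eq {color : D → TriangleColor} {l l' : List D}
    (h : (l.map M.dartUnit).prod = (l'.map M.dartUnit).prod) :
    EqvGen (M.Step color) l l' := by
  have h' := congrArg Units.val h
  rw [coe_prod_dartUnit, coe_prod_dartUnit] at h'
  have key : ∀ x y : FreeMonoid D, ConGen.Rel M.WordRel x y →
      EqvGen (M.Step color) x.toList y.toList := by
    intro x y hxy
    induction hxy with
    | of x y h =>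
      cases h with
      | spur d => exact .rel _ _ (.head [] (.spur rfl))
      | triangle d => exact .rel _ _ (.head [] (.left rfl))
    | refl x => exact .refl _
    | symm _ ih => exact .symm _ _ ih
    | trans _ _ ih₁ ih₂ => exact .trans _ _ _ ih₁ ih₂
    | mul _ _ ih₁ ih₂ =>
      rw [FreeMonoid.toList_mul, FreeMonoid.toList_mul]
      exact .trans _ _ _ (eqvGen_map (f := (· ++ _)) (fun _ _ h => Step.append_right h _) ih₁)
        (eqvGen_map (f := (_ ++ ·)) (fun _ _ h => Step.append_left h _) ih₂)
  exact key _ _ ((Con.eq _).1 h')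

/-! ### The covering associated with a cocycle -/

variable {M} {G : Type*} [Group G]

namespace Cocycle

variable (φ : M.Cocycle G)

@[simp]
theorem map_mul_rev (d : D) (g : G) : g * φ.toFun d * φ.toFun (M.rev d) = g := by
  rw [φ.map_rev, mul_inv_cancel_right]

@[simp]
theorem mul_map_face (d : D) (g : G) :
    g * φ.toFun d * φ.toFun (M.next d) * φ.toFun (M.next (M.next d)) = g := by
  rw [mul_assoc, mul_assoc, ← mul_assoc (φ.toFun d), φ.map_face, mul_one]

omit [Group G] in
theorem prodCongr_zpow_apply (k : ℤ) (d : D) (g : G) :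
    ((M.cw.prodCongr (Equiv.refl G) : Equiv.Perm (D × G)) ^ k) (d, g) = ((M.cw ^ k) d, g) := by
  induction k generalizing d with
  | zero => rfl
  | succ n ih => rw [zpow_add_one, zpow_add_one, Equiv.Perm.mul_apply, Equiv.Perm.mul_apply, ← ih]; rfl
  | pred n ih => rw [zpow_sub_one, zpow_sub_one, Equiv.Perm.mul_apply, Equiv.Perm.mul_apply, ← ih]; rfl

/-- The triangulation of the covering whose sheets are indexed by the group. -/
def cover : OrientedTriangulation (D × G) where
  rev := Function.Involutive.toPerm (fun e => (M.rev e.1, e.2 * φ.toFun e.1))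
    fun e => by simp
  rev_rev e := by simp [Function.Involutive.toPerm]
  rev_ne e h := M.rev_ne e.1 (congrArg Prod.fst h)
  cw := M.cw.prodCongr (Equiv.refl G)
  finite_cycle e := by
    refine ((M.finite_cycle e.1).image fun d => (d, e.2)).subset ?_
    rintro _ ⟨k, rfl⟩
    exact ⟨(M.cw ^ k) e.1, ⟨k, rfl⟩, (prodCongr_zpow_apply k e.1 e.2).symm⟩
  face_three e := Prod.ext (M.face_three e.1) (φ.mul_map_face e.1 e.2)
  face_ne e h := M.face_ne e.1 (congrArg Prod.fst h)

theorem cover_rev (d : D) (g : G) : φ.cover.rev (d, g) = (M.rev d, g * φ.toFun d) := rfl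

theorem cover_next (d : D) (g : G) : φ.cover.next (d, g) = (M.next d, g * φ.toFun d) := rfl

/-- The vertex of the covering that lies over `u` in the sheet `g`. -/
def coverVertex (u : M.Vertex) (g : G) : φ.cover.Vertex :=
  Quotient.map' (fun d => (d, g)) (by
    rintro d _ ⟨k, rfl⟩
    exact ⟨k, prodCongr_zpow_apply k d g⟩) u

theorem src_cover (d : D) (g : G) : φ.cover.src (d, g) = φ.coverVertex (M.src d) g := rfl

theorem tgt_cover (d : D) (g : G) :
    φ.cover.tgt (d, g) = φ.coverVertex (M.tgt d) (g * φ.toFun d) := rfl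

/-- The projection of the covering. -/
def proj : φ.cover.Realization → M.Realization :=
  Quot.map (fun p => ⟨p.1.1, p.2⟩) (by
    rintro _ _ (⟨⟨d, g⟩, x⟩ | ⟨⟨d, g⟩, x, hx⟩)
    · exact .rotate d x
    · exact .edge d x hx)

/-- Gluing multiplies the sheet on the right by the cocycle, so left multiplication respects it. -/
instance : MulAction G φ.cover.Realization where
  smul g := Quot.map (fun p => ⟨(p.1.1, g * p.1.2), p.2⟩) (by
    rintro _ _ (⟨⟨d, h⟩, x⟩ | ⟨⟨d, h⟩, x, hx⟩)
    · have := Glue.rotate (M := φ.cover) (d, g * h) x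
      rwa [cover_next, mul_assoc] at this
    · have := Glue.edge (M := φ.cover) (d, g * h) x hx
      rwa [cover_rev, mul_assoc] at this)
  one_smul := by
    rintro ⟨⟨d, h⟩, x⟩
    exact congrArg (fun k => φ.cover.toRealization (d, k) x) (one_mul h)
  mul_smul g g' := by
    rintro ⟨⟨d, h⟩, x⟩
    exact congrArg (fun k => φ.cover.toRealization (d, k) x) (mul_assoc g g' h)

theorem smul_toRealization (g : G) (d : D) (h : G) (x : stdSimplex ℝ (Fin 3)) :
    g • φ.cover.toRealization (d, h) x = φ.cover.toRealization (d, g * h) x := rfl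

end Cocycle

/-! ### Topology of the realization and open neighbourhoods. -/

variable (M) in
theorem continuous_toRealization (d : D) : Continuous (M.toRealization d) :=
  continuous_quot_mk.comp continuous_sigmaMk

variable (M) in
theorem continuous_realization_iff {X : Type*} [TopologicalSpace X] {f : M.Realization → X} :
    Continuous f ↔ ∀ d, Continuous fun x => f (M.toRealization d x) := by
  rw [show Continuous f ↔ _ from isQuotientMap_quot_mk.continuous_iff, continuous_sigma_iff]
  rfl

variable (M) in
theorem isOpen_realization_iff {U : Set M.Realization} :
    IsOpen U ↔ ∀ d, IsOpen (M.toRealization d ⁻¹' U) := by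
  rw [show IsOpen U ↔ _ from isQuotientMap_quot_mk.isOpen_preimage.symm, isOpen_sigma_iff]
  rfl

variable (M) in
theorem exists_toRealization (q : M.Realization) : ∃ d x, M.toRealization d x = q := by
  obtain ⟨⟨d, x⟩, rfl⟩ := Quot.exists_rep q
  exact ⟨d, x, rfl⟩

theorem continuous_coord (i : Fin 3) : Continuous fun x : stdSimplex ℝ (Fin 3) => x.1 i :=
  (continuous_apply i).comp continuous_subtype_val

theorem sum_coord (x : stdSimplex ℝ (Fin 3)) : x.1 0 + x.1 1 + x.1 2 = 1 := by
  rw [← Fin.sum_univ_three]; exact x.2.2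

@[simp]
theorem permute_finRotate_zero (x : stdSimplex ℝ (Fin 3)) : (permute (finRotate 3) x).1 0 = x.1 1 := by
  simp [permute]

@[simp]
theorem permute_finRotate_one (x : stdSimplex ℝ (Fin 3)) : (permute (finRotate 3) x).1 1 = x.1 2 := by
  simp [permute]

@[simp]
theorem permute_finRotate_two (x : stdSimplex ℝ (Fin 3)) : (permute (finRotate 3) x).1 2 = x.1 0 := by
  simp [permute]

@[simp]
theorem permute_swap_zero (x : stdSimplex ℝ (Fin 3)) :
    (permute (Equiv.swap 0 1) x).1 0 = x.1 1 := by
  simp [permute]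

@[simp]
theorem permute_swap_one (x : stdSimplex ℝ (Fin 3)) :
    (permute (Equiv.swap 0 1) x).1 1 = x.1 0 := by
  simp [permute]

@[simp]
theorem permute_swap_two (x : stdSimplex ℝ (Fin 3)) :
    (permute (Equiv.swap 0 1) x).1 2 = x.1 2 := by
  simp [permute, Equiv.swap_apply_def]

variable (M) in
/-- The open triangle to the left of a dart. -/
def openFace (e : D) : Set M.Realization :=
  {q | Quot.lift (fun p : (_ : D) × stdSimplex ℝ (Fin 3) =>
    (p.1 = e ∨ M.next p.1 = e ∨ M.next (M.next p.1) = e) ∧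
      0 < p.2.1 0 ∧ 0 < p.2.1 1 ∧ 0 < p.2.1 2) (by
    rintro _ _ (⟨d, x⟩ | ⟨d, x, hx⟩)
    · simp only [next_next_next, permute_finRotate_zero, permute_finRotate_one,
        permute_finRotate_two, eq_iff_iff]
      tauto
    · simp [hx]) q}

variable (M) in
/-- The open edge of a dart, together with the two incident open triangles. -/
def openEdge (e : D) : Set M.Realization :=
  {q | Quot.lift (fun p : (_ : D) × stdSimplex ℝ (Fin 3) =>
    ((p.1 = e ∨ p.1 = M.rev e) ∧ 0 < p.2.1 0 ∧ 0 < p.2.1 1) ∨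
    ((M.next p.1 = e ∨ M.next p.1 = M.rev e) ∧ 0 < p.2.1 1 ∧ 0 < p.2.1 2) ∨
    ((M.next (M.next p.1) = e ∨ M.next (M.next p.1) = M.rev e) ∧ 0 < p.2.1 2 ∧ 0 < p.2.1 0)) (by
    rintro _ _ (⟨d, x⟩ | ⟨d, x, hx⟩)
    · simp only [next_next_next, permute_finRotate_zero, permute_finRotate_one,
        permute_finRotate_two, eq_iff_iff]
      tauto
    · have h : M.rev d = e ↔ d = M.rev e := ⟨fun h => by simp [← h], fun h => by simp [h]⟩
      simp only [hx, lt_self_iff_false, and_false, false_and, or_false, permute_swap_zero,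
        permute_swap_one, permute_swap_two, M.rev.injective.eq_iff, eq_iff_iff, h]
      tauto) q}

/-- The points of the covering that are close to a vertex of the sheet `g`. -/
def Cocycle.openStar (φ : M.Cocycle G) (g : G) : Set φ.cover.Realization :=
  {q | Quot.lift (fun p : (_ : D × G) × stdSimplex ℝ (Fin 3) =>
    (p.1.2 = g ∧ 1 / 2 < p.2.1 0) ∨ (p.1.2 * φ.toFun p.1.1 = g ∧ 1 / 2 < p.2.1 1) ∨
    (p.1.2 * φ.toFun p.1.1 * φ.toFun (M.next p.1.1) = g ∧ 1 / 2 < p.2.1 2)) (by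
    rintro _ _ (⟨⟨d, h⟩, x⟩ | ⟨⟨d, h⟩, x, hx⟩)
    · simp only [Cocycle.cover_next, Cocycle.mul_map_face, permute_finRotate_zero, permute_finRotate_one,
        permute_finRotate_two, eq_iff_iff]
      tauto
    · have h0 : ¬ (1 / 2 : ℝ) < 0 := by norm_num
      simp only [Cocycle.cover_rev, Cocycle.map_mul_rev, hx, h0, and_false, or_false,
        permute_swap_zero, permute_swap_one, permute_swap_two, eq_iff_iff]
      tauto) q}

theorem isOpen_openFace (e : D) : IsOpen (M.openFace e) := by
  refine (M.isOpen_realization_iff).2 fun d => ?_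
  have h := fun i => isOpen_lt (continuous_const (y := (0 : ℝ))) (continuous_coord i)
  change IsOpen {x : stdSimplex ℝ (Fin 3) | (d = e ∨ M.next d = e ∨ M.next (M.next d) = e) ∧
    0 < x.1 0 ∧ 0 < x.1 1 ∧ 0 < x.1 2}
  exact isOpen_const.and ((h 0).and ((h 1).and (h 2)))

theorem isOpen_openEdge (e : D) : IsOpen (M.openEdge e) := by
  refine (M.isOpen_realization_iff).2 fun d => ?_
  have h := fun i => isOpen_lt (continuous_const (y := (0 : ℝ))) (continuous_coord i)
  change IsOpen {x : stdSimplex ℝ (Fin 3) | ((d = e ∨ d = M.rev e) ∧ 0 < x.1 0 ∧ 0 < x.1 1) ∨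
    ((M.next d = e ∨ M.next d = M.rev e) ∧ 0 < x.1 1 ∧ 0 < x.1 2) ∨
    ((M.next (M.next d) = e ∨ M.next (M.next d) = M.rev e) ∧ 0 < x.1 2 ∧ 0 < x.1 0)}
  exact IsOpen.union (IsOpen.and isOpen_const ((h 0).and (h 1)))
    (IsOpen.union (IsOpen.and isOpen_const ((h 1).and (h 2)))
      (IsOpen.and isOpen_const ((h 2).and (h 0))))

theorem Cocycle.isOpen_openStar (φ : M.Cocycle G) (g : G) : IsOpen (φ.openStar g) := by
  refine (φ.cover.isOpen_realization_iff).2 fun d => ?_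
  have h := fun i => isOpen_lt (continuous_const (y := (1 / 2 : ℝ))) (continuous_coord i)
  change IsOpen {x : stdSimplex ℝ (Fin 3) | (d.2 = g ∧ 1 / 2 < x.1 0) ∨
    (d.2 * φ.toFun d.1 = g ∧ 1 / 2 < x.1 1) ∨
    (d.2 * φ.toFun d.1 * φ.toFun (M.next d.1) = g ∧ 1 / 2 < x.1 2)}
  exact IsOpen.union (IsOpen.and isOpen_const (h 0))
    (IsOpen.union (IsOpen.and isOpen_const (h 1)) (IsOpen.and isOpen_const (h 2)))

theorem toRealization_rotate (d : D) (x : stdSimplex ℝ (Fin 3)) :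
    M.toRealization d x = M.toRealization (M.next d) (permute (finRotate 3) x) :=
  Quot.sound (.rotate d x)

/-- Every point has a representative that is interior to a triangle or lies on the first side. -/
theorem exists_toRealization_normal (q : M.Realization) :
    ∃ d x, M.toRealization d x = q ∧ ((0 < x.1 0 ∧ 0 < x.1 1 ∧ 0 < x.1 2) ∨ x.1 2 = 0) := by
  obtain ⟨d, x, rfl⟩ := M.exists_toRealization q
  by_cases h2 : x.1 2 = 0
  · exact ⟨d, x, rfl, .inr h2⟩
  by_cases h0 : x.1 0 = 0
  · exact ⟨_, _, (M.toRealization_rotate d x).symm, .inr (by simpa using h0)⟩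
  by_cases h1 : x.1 1 = 0
  · refine ⟨_, _, ((M.toRealization_rotate d x).trans (toRealization_rotate _ _)).symm, .inr ?_⟩
    simpa using h1
  · exact ⟨d, x, rfl, .inl ⟨(x.2.1 0).lt_of_ne' h0, (x.2.1 1).lt_of_ne' h1,
      (x.2.1 2).lt_of_ne' h2⟩⟩

/-! ### The projection is the quotient by a properly discontinuous action. -/

namespace Cocycle

variable (φ : M.Cocycle G)

/-- At most one barycentric coordinate exceeds 1/2, so both memberships concern the same corner, and
the sheets there determine `g`. -/
theorem eq_one_of_mem_openStar {g h : G} {q : φ.cover.Realization} (hq : q ∈ φ.openStar h)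
    (hgq : g • q ∈ φ.openStar h) : g = 1 := by
  obtain ⟨⟨d, k⟩, x, rfl⟩ := φ.cover.exists_toRealization q
  have h0 := x.2.1 0
  have h1 := x.2.1 1
  have h2 := x.2.1 2
  have hs := sum_coord x
  rcases hq with ⟨hk, hx⟩ | ⟨hk, hx⟩ | ⟨hk, hx⟩ <;>
  rcases hgq with ⟨hk', hx'⟩ | ⟨hk', hx'⟩ | ⟨hk', hx'⟩ <;> dsimp only at hk hk' hx hx' <;>
  first
  | (exfalso; linarith)
  | (rw [← hk] at hk'; simpa [mul_assoc] using hk')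

/-- The three darts of a face have distinct projections, so both hypotheses hold through the same
alternative. -/
theorem eq_one_of_next_eq {g k : G} {d : D} {e : D × G}
    (h : (d, k) = e ∨ φ.cover.next (d, k) = e ∨ φ.cover.next (φ.cover.next (d, k)) = e)
    (h' : (d, g * k) = e ∨ φ.cover.next (d, g * k) = e ∨
      φ.cover.next (φ.cover.next (d, g * k)) = e) : g = 1 := by
  have n1 := M.next_ne d
  have n2 := M.next_next_ne d
  have n3 := M.next_ne (M.next d)
  rcases h with rfl | rfl | rfl <;> rcases h' with h | h | h <;>
    simp only [cover_next, Prod.mk.injEq, mul_assoc, mul_eq_right] at h <;> grind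

theorem eq_one_of_mem_openFace {g : G} {e : D × G} {q : φ.cover.Realization}
    (hq : q ∈ φ.cover.openFace e) (hgq : g • q ∈ φ.cover.openFace e) : g = 1 := by
  obtain ⟨⟨d, k⟩, x, rfl⟩ := φ.cover.exists_toRealization q
  exact φ.eq_one_of_next_eq hq.1 hgq.1

/-- The action preserves colours and the two triangles along an edge have different ones. Hence `q`
and `g • q` are represented in the same triangle. -/
theorem eq_one_of_mem_openEdge {color : D → TriangleColor} (hM : M.IsDualColoring color)
    {g : G} {e : D × G} {q : φ.cover.Realization}
    (hq : q ∈ φ.cover.openEdge e) (hgq : g • q ∈ φ.cover.openEdge e) : g = 1 := by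
  obtain ⟨⟨d, k⟩, x, rfl⟩ := φ.cover.exists_toRealization q
  obtain ⟨b, c⟩ := e
  have key : ∀ k, φ.cover.toRealization (d, k) x ∈ φ.cover.openEdge (b, c) →
      (color d = color b ∧ ((d, k) = (b, c) ∨ φ.cover.next (d, k) = (b, c) ∨
        φ.cover.next (φ.cover.next (d, k)) = (b, c))) ∨
      (color d = color (M.rev b) ∧ ((d, k) = φ.cover.rev (b, c) ∨
        φ.cover.next (d, k) = φ.cover.rev (b, c) ∨
        φ.cover.next (φ.cover.next (d, k)) = φ.cover.rev (b, c))) := by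
    have c1 : ∀ {d' b'} {k k' : G}, (d', k) = (b', k') → color d' = color b' :=
      fun h => congrArg (fun e => color e.1) h
    have n1 := hM.color_next d
    have n2 := hM.color_next (M.next d)
    rintro k (⟨h | h, -⟩ | ⟨h | h, -⟩ | ⟨h | h, -⟩)
    · exact .inl ⟨c1 h, .inl h⟩
    · exact .inr ⟨c1 h, .inl h⟩
    · exact .inl ⟨n1.symm.trans (c1 h), .inr (.inl h)⟩
    · exact .inr ⟨n1.symm.trans (c1 h), .inr (.inl h)⟩
    · exact .inl ⟨(n2.trans n1).symm.trans (c1 h), .inr (.inr h)⟩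
    · exact .inr ⟨(n2.trans n1).symm.trans (c1 h), .inr (.inr h)⟩
  rcases key _ hq with ⟨hc, h⟩ | ⟨hc, h⟩ <;> rcases key _ hgq with ⟨hc', h'⟩ | ⟨hc', h'⟩
  · exact φ.eq_one_of_next_eq h h'
  · exact absurd (hc'.symm.trans hc) (hM.color_rev b)
  · exact absurd (hc.symm.trans hc') (hM.color_rev b)
  · exact φ.eq_one_of_next_eq h h'

theorem exists_nhds_disjoint {color : D → TriangleColor} (hM : M.IsDualColoring color)
    (q : φ.cover.Realization) :
    ∃ U ∈ 𝓝 q, ∀ g : G, ∀ p ∈ U, g • p ∈ U → g = 1 := by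
  obtain ⟨⟨d, k⟩, x, rfl, h | h⟩ := exists_toRealization_normal q
  · exact ⟨_, (isOpen_openFace (d, k)).mem_nhds ⟨.inl rfl, h⟩,
      fun g p hp hgp => φ.eq_one_of_mem_openFace hp hgp⟩
  have hs := sum_coord x
  -- On the side where the last coordinate vanishes, the point is one of the two ends (a star) or is
  -- interior to the edge.
  rcases (x.2.1 0).eq_or_lt' with h0 | h0
  · refine ⟨_, (φ.isOpen_openStar _).mem_nhds (.inr (.inl ⟨rfl, ?_⟩)),
      fun g p hp hgp => φ.eq_one_of_mem_openStar hp hgp⟩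
    change 1 / 2 < x.1 1
    linarith
  rcases (x.2.1 1).eq_or_lt' with h1 | h1
  · refine ⟨_, (φ.isOpen_openStar _).mem_nhds (.inl ⟨rfl, ?_⟩),
      fun g p hp hgp => φ.eq_one_of_mem_openStar hp hgp⟩
    change 1 / 2 < x.1 0
    linarith
  · exact ⟨_, (isOpen_openEdge (d, k)).mem_nhds (.inl ⟨.inl rfl, h0, h1⟩),
      fun g p hp hgp => φ.eq_one_of_mem_openEdge hM hp hgp⟩

theorem continuous_proj : Continuous φ.proj :=
  (φ.cover.continuous_realization_iff).2 fun e => M.continuous_toRealization e.1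

theorem isQuotientMap_proj : IsQuotientMap φ.proj := by
  refine (isQuotientMap_iff _).2 ⟨isCoinducing_iff.2 fun U => ?_, fun q => ?_⟩
  · refine ⟨fun hU => ?_, fun hU => hU.preimage φ.continuous_proj⟩
    exact M.isOpen_realization_iff.2 fun d => (φ.cover.isOpen_realization_iff.1 hU) (d, 1)
  · obtain ⟨d, x, rfl⟩ := M.exists_toRealization q
    exact ⟨φ.cover.toRealization (d, 1) x, rfl⟩

/-- Each gluing downstairs lifts to one that starts in sheet 1 and ends in a translate of sheet 1; a
chain of gluings multiplies the translations. -/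
theorem exists_smul_eq_of_proj_eq {p q : φ.cover.Realization} (h : φ.proj p = φ.proj q) :
    ∃ g : G, g • q = p := by
  have key : ∀ a b : (_ : D) × stdSimplex ℝ (Fin 3), EqvGen M.Glue a b →
      ∃ g : G, φ.cover.toRealization (a.1, 1) a.2 = g • φ.cover.toRealization (b.1, 1) b.2 := by
    intro a b hab
    induction hab with
    | rel a b h =>
      rcases h with ⟨d, x⟩ | ⟨d, x, hx⟩
      · refine ⟨φ.toFun d, (Quot.sound (Glue.rotate (M := φ.cover) (d, 1) x)).trans ?_⟩
        rw [smul_toRealization, cover_next, one_mul, mul_one]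
        rfl
      · refine ⟨φ.toFun d, (Quot.sound (Glue.edge (M := φ.cover) (d, 1) x hx)).trans ?_⟩
        rw [smul_toRealization, cover_rev, one_mul, mul_one]
        rfl
    | refl a => exact ⟨1, (one_smul _ _).symm⟩
    | symm a b _ ih =>
      obtain ⟨g, hg⟩ := ih
      exact ⟨g⁻¹, by rw [hg, inv_smul_smul]⟩
    | trans a b c _ _ ih₁ ih₂ =>
      obtain ⟨g, hg⟩ := ih₁
      obtain ⟨g', hg'⟩ := ih₂
      exact ⟨g * g', by rw [hg, hg', mul_smul]⟩
  obtain ⟨⟨d, k⟩, x, rfl⟩ := φ.cover.exists_toRealization p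
  obtain ⟨⟨d', k'⟩, x', rfl⟩ := φ.cover.exists_toRealization q
  obtain ⟨g, hg⟩ := key ⟨d, x⟩ ⟨d', x'⟩ (Quot.eqvGen_exact h)
  -- Move `q` to sheet 1, follow the chain of gluings, then move to the sheet of `p`.
  refine ⟨k * g * k'⁻¹, ?_⟩
  have h1 := φ.smul_toRealization k d 1 x
  have h2 := φ.smul_toRealization k' d' 1 x'
  rw [mul_one] at h1 h2
  rw [← h1, ← h2, hg, smul_smul, smul_smul, inv_mul_cancel_right]

theorem isQuotientCoveringMap_proj {color : D → TriangleColor} (hM : M.IsDualColoring color) :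
    IsQuotientCoveringMap φ.proj G where
  __ := φ.isQuotientMap_proj
  continuous_const_smul g := (φ.cover.continuous_realization_iff).2 fun e =>
    φ.cover.continuous_toRealization (e.1, g * e.2)
  apply_eq_iff_mem_orbit {p q} := by
    refine ⟨fun h => φ.exists_smul_eq_of_proj_eq h, ?_⟩
    rintro ⟨g, rfl⟩
    obtain ⟨⟨d, k⟩, x, rfl⟩ := φ.cover.exists_toRealization q
    rfl
  disjoint q := by
    obtain ⟨U, hU, h⟩ := φ.exists_nhds_disjoint hM q
    refine ⟨U, hU, ?_⟩
    rintro g ⟨_, ⟨p, hp, rfl⟩, hgp⟩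
    exact h g p hp hgp

/-! ### Lifts of walks -/

/-- The open stars detect the sheet: a vertex lies in the star of its own sheet and in no other. -/
theorem eq_of_vertexPoint_eq {u v : M.Vertex} {g h : G}
    (huv : φ.cover.vertexPoint (φ.coverVertex u g) = φ.cover.vertexPoint (φ.coverVertex v h)) :
    g = h := by
  have key : ∀ (u : M.Vertex) (g h : G),
      φ.cover.vertexPoint (φ.coverVertex u g) ∈ φ.openStar h → g = h := by
    rintro ⟨d⟩ g h (⟨hd, -⟩ | ⟨-, hx⟩ | ⟨-, hx⟩)
    · exact hd
    · exfalso; norm_num [sidePoint] at hx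
    · exact absurd hx (by change ¬ (1 / 2 : ℝ) < 0; norm_num)
  refine key u g h ?_
  rw [huv]
  obtain ⟨d⟩ := v
  refine .inl ⟨rfl, ?_⟩
  norm_num [sidePoint]

theorem exists_lift {u v : M.Vertex} (W : M.Walk u v) (g : G) :
    ∃ Γ : Path (φ.cover.vertexPoint (φ.coverVertex u g))
      (φ.cover.vertexPoint (φ.coverVertex v (g * ((Walk.darts W).map φ.toFun).prod))),
      ∀ t, φ.proj (Γ t) = Walk.toPath W t := by
  induction W with
  | nil =>
    refine ⟨(Path.refl _).cast rfl (by simp [Walk.darts]), fun t => ?_⟩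
    obtain ⟨d⟩ := u
    rfl
  | cons p d ih =>
    obtain ⟨Γ, hΓ⟩ := ih
    obtain ⟨d, rfl, rfl⟩ := d
    refine ⟨(Γ.trans ((φ.cover.dartPath (d, g * ((Walk.darts p).map φ.toFun).prod)).cast
      (congrArg _ (φ.src_cover _ _).symm) rfl)).cast rfl
      (by simp [Walk.darts, tgt_cover, mul_assoc]), fun t => ?_⟩
    change φ.proj ((Γ.trans _) t) = ((Walk.toPath p).trans _) t
    rw [Path.trans_apply, Path.trans_apply]
    split_ifs with ht
    · exact hΓ _
    · rfl

/-- Lifts of homotopic paths with a common start have a common end, and its sheet is the product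
along the walk. -/
theorem prod_eq_of_homotopic {color : D → TriangleColor} (hM : M.IsDualColoring color)
    {u v : M.Vertex} {W₁ W₂ : M.Walk u v}
    (h : Path.Homotopic (Walk.toPath W₁) (Walk.toPath W₂)) :
    ((Walk.darts W₁).map φ.toFun).prod = ((Walk.darts W₂).map φ.toFun).prod := by
  have cov := (φ.isQuotientCoveringMap_proj hM).isCoveringMap
  obtain ⟨Γ₁, h₁⟩ := φ.exists_lift W₁ 1
  obtain ⟨Γ₂, h₂⟩ := φ.exists_lift W₂ 1
  have e₁ : (Walk.toPath W₁ : C(unitInterval, M.Realization)) 0 =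
      φ.proj (φ.cover.vertexPoint (φ.coverVertex u 1)) := by
    rw [← Γ₁.source, h₁]; rfl
  have e₂ : (Walk.toPath W₂ : C(unitInterval, M.Realization)) 0 =
      φ.proj (φ.cover.vertexPoint (φ.coverVertex u 1)) := by
    rw [← Γ₂.source, h₂]; rfl
  have key := cov.liftPath_apply_one_eq_of_homotopicRel h _ e₁ e₂
  have l₁ := (cov.eq_liftPath_iff' (Γ := Γ₁.toContinuousMap) e₁).2 ⟨funext h₁, Γ₁.source⟩
  have l₂ := (cov.eq_liftPath_iff' (Γ := Γ₂.toContinuousMap) e₂).2 ⟨funext h₂, Γ₂.source⟩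
  have key' : Γ₁ 1 = Γ₂ 1 :=
    ((congrArg (fun γ : C(unitInterval, φ.cover.Realization) => γ 1) l₁).trans key).trans
      (congrArg (fun γ : C(unitInterval, φ.cover.Realization) => γ 1) l₂).symm
  have := φ.eq_of_vertexPoint_eq ((Γ₁.target.symm.trans key').trans Γ₂.target)
  simpa using this

end Cocycle

theorem IsReducing.darts_eq_of_homotopic {color : D → TriangleColor} (hM : M.IsReducing color)
    {u v : M.Vertex} {W₁ W₂ : M.Walk u v} (h₁ : Walk.IsReduced color W₁)
    (h₂ : Walk.IsReduced color W₂)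
    (h : Path.Homotopic (Walk.toPath W₁) (Walk.toPath W₂)) : Walk.darts W₁ = Walk.darts W₂ :=
  hM.eq_of_eqvGen ((hM.isChain_iff _).1 h₁) ((hM.isChain_iff _).1 h₂)
    (M.eqvGen_step_of_prod_eq (M.universalCocycle.prod_eq_of_homotopic hM.coloring h))

/-- The targets are allowed to differ because the induction removes the last dart, whose source is
not known in advance to agree. -/
theorem Walk.eq_of_darts_eq {u v w : M.Vertex} {W : M.Walk u v} {W' : M.Walk u w}
    (h : Walk.darts W = Walk.darts W') : v = w ∧ HEq W W' := by
  induction W generalizing w with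
  | nil =>
    cases W' with
    | nil => exact ⟨rfl, .rfl⟩
    | cons p d => simp [Walk.darts] at h
  | cons p d ih =>
    cases W' with
    | nil => simp [Walk.darts] at h
    | cons p' d' =>
      obtain ⟨h1, h2⟩ := List.append_inj' h rfl
      obtain ⟨rfl, h3⟩ := ih h1
      obtain ⟨d, rfl, rfl⟩ := d
      obtain ⟨d', h4, rfl⟩ := d'
      obtain rfl : d = d' := by simpa using h2
      obtain rfl := eq_of_heq h3
      exact ⟨rfl, .rfl⟩

end OrientedTriangulation

namespace OrientedTriangulation

variable {D : Type*} {M : OrientedTriangulation D}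

/-! ### Homotopies between walks -/

namespace Walk

/-- Two walks that are homotopic in the realization. -/
def Homotopic {u v : M.Vertex} (W W' : M.Walk u v) : Prop :=
  Path.Homotopic (toPath W) (toPath W')

theorem Homotopic.trans {u v : M.Vertex} {W₁ W₂ W₃ : M.Walk u v} (h : Homotopic W₁ W₂)
    (h' : Homotopic W₂ W₃) : Homotopic W₁ W₃ :=
  Path.Homotopic.trans h h'

theorem toPath_comp {u v w : M.Vertex} (W : M.Walk u v) (W' : M.Walk v w) :
    Path.Homotopic (toPath (Quiver.Path.comp W W')) ((toPath W).trans (toPath W')) := by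
  induction W' with
  | nil => exact (Path.Homotopic.trans_refl _).symm
  | cons p d ih =>
    exact (Path.Homotopic.hcomp ih (.refl _)).trans (Path.Homotopic.trans_assoc _ _ _)

theorem Homotopic.comp {u v w : M.Vertex} {W₁ W₂ : M.Walk u v} {W₁' W₂' : M.Walk v w}
    (h : Homotopic W₁ W₂) (h' : Homotopic W₁' W₂') :
    Homotopic (Quiver.Path.comp W₁ W₁') (Quiver.Path.comp W₂ W₂') :=
  ((toPath_comp _ _).trans (Path.Homotopic.hcomp h h')).trans (toPath_comp _ _).symm

theorem darts_comp {u v w : M.Vertex} (W : M.Walk u v) (W' : M.Walk v w) :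
    darts (Quiver.Path.comp W W') = darts W ++ darts W' := by
  induction W' with
  | nil => simp [darts]
  | cons p d ih => simp [darts, ih]

theorem exists_comp_of_darts_eq_append {u v : M.Vertex} (W : M.Walk u v) {l l' : List D}
    (h : darts W = l ++ l') : ∃ (w : M.Vertex) (W₁ : M.Walk u w) (W₂ : M.Walk w v),
      W = Quiver.Path.comp W₁ W₂ ∧ darts W₁ = l ∧ darts W₂ = l' := by
  induction W generalizing l' with
  | nil =>
    obtain ⟨rfl, rfl⟩ := List.append_eq_nil_iff.1 h.symm
    exact ⟨_, .nil, .nil, rfl, rfl, rfl⟩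
  | cons p d ih =>
    rcases List.eq_nil_or_concat l' with rfl | ⟨l', a, rfl⟩
    · exact ⟨_, .cons p d, .nil, rfl, by simpa using h, rfl⟩
    · rw [List.concat_eq_append, ← List.append_assoc] at h
      obtain ⟨h1, h2⟩ := List.append_inj' h rfl
      obtain ⟨w, W₁, W₂, rfl, h3, h4⟩ := ih h1
      refine ⟨w, W₁, .cons W₂ d, rfl, h3, ?_⟩
      rw [darts, h4, h2, List.concat_eq_append]

theorem toPath_single {u v : M.Vertex} (f : u ⟶ v) :
    Path.Homotopic (toPath (Quiver.Path.cons .nil f)) ((M.dartPath f.1).cast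
      (congrArg M.vertexPoint f.2.1.symm) (congrArg M.vertexPoint f.2.2.symm)) :=
  Path.Homotopic.refl_trans _

theorem homotopic_spur {u v : M.Vertex} (f : u ⟶ v) (g : v ⟶ u) (h : g.1 = M.rev f.1) :
    Homotopic (Quiver.Path.cons (.cons .nil f) g) .nil := by
  obtain ⟨d, rfl, rfl⟩ := f
  obtain ⟨_, h1, h2⟩ := g
  obtain rfl := h
  refine (Path.Homotopic.hcomp (toPath_single _) (.refl _)).trans ?_
  refine Path.Homotopic.trans ?_ (Path.Homotopic.trans_symm (M.dartPath d))
  refine Path.Homotopic.hcomp (.refl _) ?_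
  -- The path of `M.rev d` is pointwise the reverse of the path of `d`.
  convert! Path.Homotopic.refl _ using 1
  ext t
  have := M.toRealization_rev d (unitInterval.symm t)
  rwa [unitInterval.symm_symm] at this

end Walk

/-! ### Homotopies across a triangle. -/

theorem continuous_permute (σ : Equiv.Perm (Fin 3)) : Continuous (permute σ) :=
  Continuous.subtype_mk (continuous_pi fun i => continuous_coord (σ i)) _

instance : ContractibleSpace (stdSimplex ℝ (Fin 3)) :=
  (convex_stdSimplex ℝ (Fin 3)).contractibleSpace ⟨_, (sidePoint 0).2⟩

theorem permute_permute (σ τ : Equiv.Perm (Fin 3)) (x : stdSimplex ℝ (Fin 3)) :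
    permute σ (permute τ x) = permute (τ * σ) x := rfl

theorem permute_one (x : stdSimplex ℝ (Fin 3)) : permute 1 x = x := rfl

theorem toRealization_next_apply (d : D) (x : stdSimplex ℝ (Fin 3)) :
    M.toRealization (M.next d) x = M.toRealization d (permute (finRotate 3)⁻¹ x) := by
  rw [toRealization_rotate d, permute_permute, inv_mul_cancel, permute_one]

/-- A path along a side of the triangle. -/
def sidePath (σ : Equiv.Perm (Fin 3)) :
    Path (permute σ (sidePoint 0)) (permute σ (sidePoint 1)) where
  toFun t := permute σ (sidePoint t)
  continuous_toFun := (continuous_permute σ).comp continuous_sidePoint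
  source' := rfl
  target' := rfl

/-- Paths with the same ends are homotopic in the simply connected `Y`, here a closed triangle, and
`f` carries the homotopy to `X`. The pointwise hypotheses absorb endpoints that agree only
propositionally. -/
theorem homotopic_of_factor {X Y : Type*} [TopologicalSpace X] [TopologicalSpace Y]
    [SimplyConnectedSpace Y] {f : Y → X} (hf : Continuous f) {y₀ y₁ y₂ : Y} (a : Path y₀ y₁)
    (b : Path y₁ y₂) (c : Path y₀ y₂) {x₀ x₁ x₂ : X} {p : Path x₀ x₁} {q : Path x₁ x₂}
    {r : Path x₀ x₂} (hp : ∀ t, f (a t) = p t) (hq : ∀ t, f (b t) = q t)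
    (hr : ∀ t, f (c t) = r t) : Path.Homotopic (p.trans q) r := by
  obtain rfl : f y₀ = x₀ := by simpa using hp 0
  obtain rfl : f y₁ = x₁ := by simpa using hp 1
  obtain rfl : f y₂ = x₂ := by simpa using hq 1
  obtain rfl : a.map hf = p := Path.ext (funext hp)
  obtain rfl : b.map hf = q := Path.ext (funext hq)
  obtain rfl : c.map hf = r := Path.ext (funext hr)
  rw [← Path.map_trans]
  exact (SimplyConnectedSpace.paths_homotopic (a.trans b) c).map ⟨f, hf⟩

theorem Walk.homotopic_triangle {u v w : M.Vertex} (f : u ⟶ v) (g : v ⟶ w) (k : u ⟶ w)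
    (hg : g.1 = M.next f.1) (hk : k.1 = M.rev (M.next (M.next f.1))) :
    Homotopic (Quiver.Path.cons (.cons .nil f) g) (.cons .nil k) := by
  obtain ⟨d, hd, hd'⟩ := f
  obtain ⟨_, hg, hg'⟩ := g
  obtain ⟨_, hk, hk'⟩ := k
  dsimp only at hg hk
  subst hg hk
  have i0 : (finRotate 3)⁻¹ 0 = 2 := by decide
  have i1 : (finRotate 3)⁻¹ 1 = 0 := by decide
  have i2 : (finRotate 3)⁻¹ 2 = 1 := by decide
  have hsq : (finRotate 3)⁻¹ * (finRotate 3)⁻¹ = finRotate 3 := by decide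
  have e₁ : permute 1 (sidePoint 1) = permute (finRotate 3)⁻¹ (sidePoint 0) := by
    refine Subtype.ext (funext fun i => ?_)
    fin_cases i <;> simp [permute, sidePoint, i0, i1, i2, -Equiv.Perm.coe_inv]
  have e₂ : permute 1 (sidePoint 0) =
      permute (finRotate 3) (sidePoint 1) := by
    refine Subtype.ext (funext fun i => ?_)
    fin_cases i <;> simp [permute, sidePoint]
  have e₃ : permute (finRotate 3)⁻¹ (sidePoint 1) =
      permute (finRotate 3) (sidePoint 0) := by
    refine Subtype.ext (funext fun i => ?_)
    fin_cases i <;> simp [permute, sidePoint]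
  refine (Path.Homotopic.hcomp (toPath_single _) (.refl _)).trans
    (Path.Homotopic.trans ?_ (toPath_single _).symm)
  refine homotopic_of_factor (M.continuous_toRealization d) (sidePath 1)
    ((sidePath (finRotate 3)⁻¹).cast e₁ rfl)
    ((sidePath (finRotate 3)).symm.cast e₂ e₃) (fun t => rfl)
    (fun t => (toRealization_next_apply d _).symm) (fun t => ?_)
  -- The third side is traversed backwards; two inverse rotations, that is one rotation, bring it
  -- into the triangle of `d`.
  have h := M.toRealization_rev (M.next (M.next d)) (unitInterval.symm t)
  rw [unitInterval.symm_symm, toRealization_next_apply, toRealization_next_apply,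
    permute_permute, hsq] at h
  exact h

theorem Walk.exists_of_darts_eq_one {u v : M.Vertex} (W : M.Walk u v) {a : D}
    (h : darts W = [a]) : ∃ f : u ⟶ v, W = .cons .nil f ∧ f.1 = a := by
  rcases W with _ | ⟨_ | ⟨p, e⟩, f⟩
  · simp [darts] at h
  · exact ⟨f, rfl, by simpa [darts] using h⟩
  · have := congrArg List.length h
    simp [darts] at this

theorem Walk.exists_of_darts_eq_two {u v : M.Vertex} (W : M.Walk u v) {a b : D}
    (h : darts W = [a, b]) : ∃ (w : M.Vertex) (f : u ⟶ w) (g : w ⟶ v),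
      W = .cons (.cons .nil f) g ∧ f.1 = a ∧ g.1 = b := by
  obtain ⟨w, W₁, W₂, rfl, h₁, h₂⟩ := W.exists_comp_of_darts_eq_append (l := [a]) (l' := [b]) h
  obtain ⟨f, rfl, hf⟩ := W₁.exists_of_darts_eq_one h₁
  obtain ⟨g, rfl, hg⟩ := W₂.exists_of_darts_eq_one h₂
  exact ⟨w, f, g, rfl, hf, hg⟩

/-! ### Replacements of subwalks -/

/-- Every walk along `l` is homotopic to a walk along `l'`. -/
def Replaceable (M : OrientedTriangulation D) (l l' : List D) : Prop :=
  ∀ ⦃u v : M.Vertex⦄ (W : M.Walk u v), Walk.darts W = l →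
    ∃ W' : M.Walk u v, Walk.darts W' = l' ∧ Walk.Homotopic W W'

namespace Replaceable

theorem refl (l : List D) : M.Replaceable l l := fun _ _ W h => ⟨W, h, .refl _⟩

theorem trans {l₁ l₂ l₃ : List D} (h : M.Replaceable l₁ l₂) (h' : M.Replaceable l₂ l₃) :
    M.Replaceable l₁ l₃ := fun _ _ W hW => by
  obtain ⟨W', hW', e⟩ := h W hW
  obtain ⟨W'', hW'', e'⟩ := h' W' hW'
  exact ⟨W'', hW'', e.trans e'⟩

theorem append {l₁ l₂ l₁' l₂' : List D} (h : M.Replaceable l₁ l₂) (h' : M.Replaceable l₁' l₂') :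
    M.Replaceable (l₁ ++ l₁') (l₂ ++ l₂') := fun _ _ W hW => by
  obtain ⟨w, W₁, W₂, rfl, h₁, h₂⟩ := Walk.exists_comp_of_darts_eq_append W hW
  obtain ⟨W₁', h₁', e₁⟩ := h W₁ h₁
  obtain ⟨W₂', h₂', e₂⟩ := h' W₂ h₂
  exact ⟨_, by rw [Walk.darts_comp, h₁', h₂'], e₁.comp e₂⟩

theorem spur (d : D) : M.Replaceable [d, M.rev d] [] := fun u v W hW => by
  obtain ⟨w, f, g, rfl, hf, hg⟩ := Walk.exists_of_darts_eq_two W hW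
  obtain rfl : v = u := by
    rw [← g.2.2, ← f.2.1, hf, hg, tgt_rev]
  exact ⟨.nil, rfl, Walk.homotopic_spur f g (by rw [hf, hg])⟩

theorem triangle (d : D) :
    M.Replaceable [d, M.next d] [M.rev (M.next (M.next d))] := fun u v W hW => by
  obtain ⟨w, f, g, rfl, hf, hg⟩ := Walk.exists_of_darts_eq_two W hW
  have hu : M.src (M.rev (M.next (M.next d))) = u := by
    rw [← f.2.1, hf, ← tgt, ← src_next, next_next_next]
  have hv : M.tgt (M.rev (M.next (M.next d))) = v := by
    rw [← g.2.2, hg, tgt_rev, src_next]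
  exact ⟨.cons .nil ⟨M.rev (M.next (M.next d)), hu, hv⟩, rfl,
    Walk.homotopic_triangle f g _ (by rw [hf, hg]) (by rw [hf])⟩

/-- `Replaceable` is not symmetric by definition: the longer walk has to be constructed with the
right endpoints. -/
theorem triangle_symm (d : D) :
    M.Replaceable [M.rev (M.next (M.next d))] [d, M.next d] := fun u v W hW => by
  obtain ⟨k, rfl, hk⟩ := Walk.exists_of_darts_eq_one W hW
  have hu : M.src d = u := by
    rw [← k.2.1, hk, ← tgt, ← src_next, next_next_next]
  have hv : M.tgt (M.next d) = v := by
    rw [← k.2.2, hk, tgt_rev, src_next]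
  exact ⟨.cons (.cons .nil ⟨d, hu, rfl⟩) ⟨M.next d, M.src_next d, hv⟩, rfl,
    (Walk.homotopic_triangle _ _ k rfl hk).symm⟩

/-- Replace a dart with the two other sides of the triangle on its right. -/
theorem expandRight (d : D) :
    M.Replaceable [d] [M.next (M.rev d), M.next (M.next (M.rev d))] := by
  simpa using triangle_symm (M := M) (M.next (M.rev d))

/-- Contract two sides of the triangle on the right. -/
theorem contractRight (d : D) :
    M.Replaceable [d, M.rev (M.next (M.next (M.rev d)))] [M.next (M.rev d)] :=
  ((refl [d]).append (triangle_symm (M.rev d))).trans ((spur d).append (refl [M.next (M.rev d)]))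

/-- Replace a dart with the two other sides of the triangle on its left. -/
theorem expandLeft (d : D) :
    M.Replaceable [d] [M.rev (M.next (M.next d)), M.rev (M.next d)] := fun u v W hW => by
  obtain ⟨f, rfl, hf⟩ := Walk.exists_of_darts_eq_one W hW
  have h₁ : M.src (M.rev (M.next (M.next d))) = u := by
    rw [← f.2.1, hf, ← tgt, ← src_next, next_next_next]
  have h₂ : M.src (M.rev (M.next d)) = M.tgt (M.rev (M.next (M.next d))) := by
    rw [tgt_rev, src_next, tgt]
  have h₃ : M.tgt (M.rev (M.next d)) = v := by
    rw [← f.2.2, hf, tgt_rev, src_next]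
  let W' : M.Walk u v := .cons (.cons .nil ⟨M.rev (M.next (M.next d)), h₁, rfl⟩)
    ⟨M.rev (M.next d), h₂, h₃⟩
  have hW' : Walk.darts W' = [M.rev (M.next (M.next d)), M.rev (M.next d)] := rfl
  -- Contracting `W'` gives a walk along `[d]`, which is `W` since the darts determine the walk; the
  -- homotopy is then reversed.
  have h := contractRight (M := M) (M.rev (M.next (M.next d)))
  rw [rev_rev', next_next_next, next_next_next] at h
  obtain ⟨W'', hd, hh⟩ := h W' hW'
  exact ⟨W', hW', eq_of_heq (Walk.eq_of_darts_eq (hd.trans hW.symm)).2 ▸ hh.symm⟩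

theorem of_shortcut {color : D → TriangleColor} {a b : D} {m : List D}
    (h : M.Shortcut color a b m) : M.Replaceable [a, b] m := by
  rcases h with h | h | h | ⟨-, h⟩ | ⟨-, h⟩ <;> subst h
  · exact spur a
  · exact triangle a
  · exact contractRight a
  -- Each dart is pushed across its left triangle; these triangles share the edge of `M.next a`,
  -- which becomes a spur in the middle and cancels.
  · refine ((expandLeft a).append (expandLeft (M.next (M.rev (M.next a))))).trans ?_
    have h := ((refl (M := M) [M.rev (M.next (M.next a))]).append (spur (M.rev (M.next a)))).append
      (refl [M.rev (M.next (M.next (M.rev (M.next a))))])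
    simpa using h
  · refine ((expandRight a).append (expandRight _)).trans ?_
    have h := ((refl (M := M) [M.next (M.rev a)]).append (spur (M.next (M.next (M.rev a))))).append
      (refl [M.next (M.rev (M.next (M.next (M.rev a))))])
    simpa using h

theorem of_step {color : D → TriangleColor} {l l' : List D} (h : M.Step color l l') :
    M.Replaceable l l' := by
  induction h with
  | head l h => exact (of_shortcut h).append (refl l)
  | cons a h ih => exact (refl [a]).append ih

end Replaceable

theorem IsReducing.exists_isReduced_homotopic {color : D → TriangleColor}
    (hM : M.IsReducing color) {u v : M.Vertex} (W : M.Walk u v) :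
    ∃ W' : M.Walk u v, Walk.IsReduced color W' ∧ Walk.Homotopic W W' := by
  generalize hl : Walk.darts W = l
  induction l using (Step.wellFounded hM.coloring).induction generalizing W with
  | _ l ih =>
    by_cases h : ∃ l', M.Step color l l'
    · obtain ⟨l', h⟩ := h
      obtain ⟨W', hW', e⟩ := Replaceable.of_step h W hl
      obtain ⟨W'', hW'', e'⟩ := ih l' h W' hW'
      exact ⟨W'', hW'', e.trans e'⟩
    · refine ⟨W, (hM.isChain_iff _).2 fun l' hl' => h ⟨l', hl ▸ hl'⟩, .refl _⟩

end OrientedTriangulation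

/-! ### Transfer to the surface and conclusion. -/

theorem SurfaceTriangulation.homotopic_iff {D S : Type*} [TopologicalSpace S]
    (T : SurfaceTriangulation D S) {u v : T.Vertex} (W₁ W₂ : T.Walk u v) :
    T.Homotopic W₁ W₂ ↔ OrientedTriangulation.Walk.Homotopic W₁ W₂ := by
  refine ⟨fun h => ?_, fun h => Path.Homotopic.map h ⟨_, T.homeo.continuous⟩⟩
  have h' := (Path.Homotopic.map h ⟨_, T.homeo.symm.continuous⟩).pathCast
    (T.homeo.symm_apply_apply _).symm (T.homeo.symm_apply_apply _).symm
  have e : ∀ W : T.Walk u v, ((T.walkPath W).map T.homeo.symm.continuous).cast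
      (T.homeo.symm_apply_apply _).symm (T.homeo.symm_apply_apply _).symm =
      OrientedTriangulation.Walk.toPath W :=
    fun W => Path.ext (funext fun t => T.homeo.symm_apply_apply _)
  rw [OrientedTriangulation.Walk.Homotopic, ← e W₁, ← e W₂]
  exact h'

end

theorem mainTheorem4 {D S : Type*} [TopologicalSpace S] (T : SurfaceTriangulation D S)
    (color : D → TriangleColor) (hT : T.IsReducing color) :
    (∀ (u v : T.Vertex) (W₁ W₂ : T.Walk u v),
      OrientedTriangulation.Walk.IsReduced color W₁ →
      OrientedTriangulation.Walk.IsReduced color W₂ →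
      T.Homotopic W₁ W₂ → W₁ = W₂) ∧
    (∀ (u v : T.Vertex) (W : T.Walk u v),
      ∃! W' : T.Walk u v,
        OrientedTriangulation.Walk.IsReduced color W' ∧ T.Homotopic W W') := by
  have key : ∀ (u v : T.Vertex) (W₁ W₂ : T.Walk u v),
      OrientedTriangulation.Walk.IsReduced color W₁ →
      OrientedTriangulation.Walk.IsReduced color W₂ →
      T.Homotopic W₁ W₂ → W₁ = W₂ := fun u v W₁ W₂ h₁ h₂ h =>
    eq_of_heq (OrientedTriangulation.Walk.eq_of_darts_eq
      (hT.darts_eq_of_homotopic h₁ h₂ ((T.homotopic_iff _ _).1 h))).2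
  refine ⟨key, fun u v W => ?_⟩
  obtain ⟨W', h, e⟩ := hT.exists_isReduced_homotopic W
  have e' := (T.homotopic_iff _ _).2 e
  exact ⟨W', ⟨h, e'⟩, fun W'' ⟨h'', e''⟩ => key u v W'' W' h'' h (e''.symm.trans e')⟩
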